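/- For integers $n,p\ge 1$ let $\boldsymbol J=(J_{i_1,\dots,i_p})_{1\le i_1,\dots,i_p\le n}$ have i.i.d. standard normal entries, and for $\boldsymbol\sigma\in\{-1,1\}^n$ let \[ H_{n,p}(\boldsymbol\sigma)=n^{-\frac{p+1}{2}}\sum_{1\le i_1,\dots,i_p\le n}J_{i_1,\dots,i_p}\,\boldsymbol\sigma_{i_1}\cdots\boldsymbol\sigma_{i_p} \] be the Ising pure $p$-spin Hamiltonian. For an integer $m\ge 1$ and real numbers $\gamma,\xi,\eta$, let $S(\gamma,m,\xi,\eta)$ be the (random) set of all $m$-tuples $(\boldsymbol\sigma^{(1)},\dots,\boldsymbol\sigma^{(m)})$ of elements of $\{-1,1\}^n$ such that $H_{n,p}(\boldsymbol\sigma^{(t)})\ge\gamma\sqrt{2\ln 2}$ for all $1\le t\le m$, and $\frac1n\sum_{i=1}^n\boldsymbol\sigma^{(t)}_i\boldsymbol\sigma^{(\ell)}_i\in[\xi-\eta,\xi]$ for all $1\le t<\ell\le m$. Theorem. For any integer $m\ge 1$, any real $\gamma<1/\sqrt m$ and any $0<\eta<\xi<1$, there exists $P^*\in\mathbb N$ such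 that the following holds for every fixed $p\ge P^*$: as $n\to\infty$, \[ \mathbb P\bigl[S(\gamma,m,\xi,\eta)\neq\varnothing\bigr]\ge 1-e^{-\Theta(n)}, \] that is, there are $c>0$ and $N\in\mathbb N$ (which may depend on $m,\gamma,\xi,\eta,p$) such that $\mathbb P[S(\gamma,m,\xi,\eta)\neq\varnothing]\ge 1-e^{-cn}$ for all $n\ge N$. -/

import Mathlib

namespace PSpin

/-- The discrete hypercube `{-1, 1} ^ n`; the two spins are the units `1` and `-1` of `ℤ`. -/
abbrev Config (n : ℕ) : Type := Fin n → ℤˣ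

/-- The value of the `i`-th spin, as a real number equal to `1` or `-1`. -/
def spin {n : ℕ} (σ : Config n) (i : Fin n) : ℝ := ((σ i : ℤ) : ℝ)

/-- Real tensors of order `p` and side `n`; `J i` is the entry with the indices `i 0, …, i (p - 1)`. -/
abbrev Disorder (n p : ℕ) : Type := (Fin p → Fin n) → ℝ

/-- The law of a tensor with i.i.d. standard normal entries. -/
noncomputable def disorderLaw (n p : ℕ) : MeasureTheory.Measure (Disorder n p) :=
  MeasureTheory.Measure.pi fun _ => ProbabilityTheory.gaussianReal 0 1

/-- The Ising pure `p`-spin Hamiltonian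
`H(σ) = n ^ (-(p + 1) / 2) * ∑_{i_1, …, i_p} J_{i_1, …, i_p} σ_{i_1} ⋯ σ_{i_p}`. -/
noncomputable def hamiltonian {n p : ℕ} (J : Disorder n p) (σ : Config n) : ℝ :=
  (n : ℝ) ^ (-((p : ℝ) + 1) / 2) * ∑ i : Fin p → Fin n, J i * ∏ k : Fin p, spin σ (i k)

/-- The normalized overlap `n⁻¹ ⟨σ, τ⟩`. -/
noncomputable def overlap {n : ℕ} (σ τ : Config n) : ℝ :=
  (n : ℝ)⁻¹ * ∑ i : Fin n, spin σ i * spin τ i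

/-- The set `S(γ, m, ξ, η)` of all `m`-tuples of configurations whose energies are all at least
`γ √(2 ln 2)` and whose pairwise normalized overlaps all lie in `[ξ - η, ξ]`. -/
def nearOptimalTuples {n p : ℕ} (J : Disorder n p) (γ : ℝ) (m : ℕ) (ξ η : ℝ) :
    Set (Fin m → Config n) :=
  {σ | (∀ t : Fin m, γ * Real.sqrt (2 * Real.log 2) ≤ hamiltonian J (σ t)) ∧
    ∀ t l : Fin m, t < l → overlap (σ t) (σ l) ∈ Set.Icc (ξ - η) ξ}

end PSpin

open MeasureTheory ProbabilityTheory Real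

namespace PSpin


/-! The energies `H(σ)` and `H(τ)` have covariance `overlap σ τ ^ p / n`, so for large `p`
configurations whose overlaps stay away from `±1` are almost independent. Fix one pattern `v` of `m`
configurations with pairwise overlaps in `[ξ - η, ξ]`. Coordinatewise multiplication by any `σ`
preserves these overlaps, which gives `2 ^ n` candidate tuples. Each reaches level `b` with
probability about `exp (-n m b² / 2)`; for `b = g √(2 log 2)` with `g ≥ 0`, the condition `g < 1 /
√m` is `m b² / 2 < log 2`, so exponentially many successes are expected.

The second moment method compares pairs of translates: nearly independent ones, and the few with
some cross overlap close to `±1`. At fixed `p` the comparison loses a factor `exp (n e)`, where `e >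
0` can be made small by enlarging `p`. Hence it only gives success probability at least `exp (-n e)
/ C` (`exists_le_measureReal_tupleEvent`).

Gaussian concentration repairs this: the probability of success at level `b` times that of failure
at a lower level `a` is at most a constant times `exp (-n (b - a)² / 32)`, a rate free of `p`
(`exists_measureReal_tupleEvent_mul_le`). Taking `e` below this rate makes failure at level `a`
exponentially unlikely. -/

instance isProbabilityMeasure_disorderLaw (n p : ℕ) : IsProbabilityMeasure (disorderLaw n p) := by
  unfold disorderLaw; infer_instance

/-! ### Exponential moments of the Hamiltonian -/

theorem integrable_exp_linear {ι : Type*} [Fintype ι] (a : ι → ℝ) :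
    Integrable (fun J : ι → ℝ => exp (∑ i, a i * J i)) (Measure.pi fun _ => gaussianReal 0 1) := by
  simp_rw [exp_sum]
  exact Integrable.fintype_prod (f := fun i x => exp (a i * x))
    fun i => integrable_exp_mul_gaussianReal (a i)

theorem integral_exp_linear {ι : Type*} [Fintype ι] (a : ι → ℝ) :
    ∫ J : ι → ℝ, exp (∑ i, a i * J i) ∂(Measure.pi fun _ => gaussianReal 0 1) =
      exp (∑ i, a i ^ 2 / 2) := by
  simp_rw [exp_sum]
  rw [integral_fintype_prod_eq_prod (fun i x => exp (a i * x))]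
  refine Finset.prod_congr rfl fun i _ => ?_
  have h := mgf_gaussianReal (p := gaussianReal 0 1) (X := id) (μ := 0) (v := 1) (by simp) (a i)
  simpa [mgf] using h

theorem sum_prod_spin_mul_prod_spin {n p : ℕ} (σ τ : Config n) :
    ∑ i : Fin p → Fin n, (∏ k, spin σ (i k)) * ∏ k, spin τ (i k) =
      (∑ i, spin σ i * spin τ i) ^ p := by
  simp_rw [← Finset.prod_mul_distrib]
  rw [Fintype.sum_pow]

theorem sum_mul_hamiltonian {n p : ℕ} {ι : Type*} [Fintype ι] (J : Disorder n p)
    (σ : ι → Config n) (c : ι → ℝ) :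
    n * ∑ t, c t * hamiltonian J (σ t) =
      ∑ i, (n * (n : ℝ) ^ (-((p : ℝ) + 1) / 2) * ∑ t, c t * ∏ k, spin (σ t) (i k)) * J i := by
  simp_rw [hamiltonian, Finset.mul_sum, Finset.sum_mul]
  rw [Finset.sum_comm]
  refine Finset.sum_congr rfl fun i _ => Finset.sum_congr rfl fun t _ => ?_
  ring

theorem integrable_exp_sum_hamiltonian {n p : ℕ} {ι : Type*} [Fintype ι]
    (σ : ι → Config n) (c : ι → ℝ) :
    Integrable (fun J : Disorder n p => exp (n * ∑ t, c t * hamiltonian J (σ t)))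
      (disorderLaw n p) := by
  simp_rw [sum_mul_hamiltonian]
  exact integrable_exp_linear _

/-- The exponent is linear in the Gaussian entries, and expanding its variance leaves products of
spins whose sum over all index tuples factors into the `p`-th power of an inner product. This is the
only place where the covariance is computed. -/
theorem integral_exp_sum_hamiltonian {n p : ℕ} (hn : n ≠ 0) {ι : Type*} [Fintype ι]
    (σ : ι → Config n) (c : ι → ℝ) :
    ∫ J : Disorder n p, exp (n * ∑ t, c t * hamiltonian J (σ t)) ∂(disorderLaw n p) =
      exp (n / 2 * ∑ t, ∑ s, c t * c s * overlap (σ t) (σ s) ^ p) := by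
  have hn' : (0 : ℝ) < n := by positivity
  simp_rw [sum_mul_hamiltonian, disorderLaw]
  rw [integral_exp_linear]
  congr 1
  have h : ((n : ℝ) ^ (-((p : ℝ) + 1) / 2)) ^ 2 = ((n : ℝ)⁻¹) ^ (p + 1) := by
    rw [← rpow_natCast, ← rpow_mul hn'.le, inv_pow, ← rpow_natCast, ← rpow_neg hn'.le]
    congr 1
    push_cast
    ring
  have h2 : ∑ i : Fin p → Fin n, (∑ t, c t * ∏ k, spin (σ t) (i k)) ^ 2 =
      ∑ t, ∑ s, c t * c s * (∑ i, spin (σ t) i * spin (σ s) i) ^ p := by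
    simp_rw [← sum_prod_spin_mul_prod_spin, sq, Finset.sum_mul_sum, Finset.mul_sum]
    rw [Finset.sum_comm]
    refine Finset.sum_congr rfl fun t _ => ?_
    rw [Finset.sum_comm]
    refine Finset.sum_congr rfl fun s _ => Finset.sum_congr rfl fun i _ => ?_
    ring
  simp_rw [mul_pow, ← Finset.sum_div, ← Finset.mul_sum, h, h2, overlap, mul_pow, Finset.mul_sum,
    Finset.sum_div]
  refine Finset.sum_congr rfl fun t _ => Finset.sum_congr rfl fun s _ => ?_
  rw [pow_succ (n : ℝ)⁻¹ p]
  generalize ((n : ℝ)⁻¹) ^ p = z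
  field_simp

theorem continuous_hamiltonian {n p : ℕ} (σ : Config n) :
    Continuous fun J : Disorder n p => hamiltonian J σ := by
  unfold hamiltonian; fun_prop

theorem measurable_hamiltonian {n p : ℕ} (σ : Config n) :
    Measurable fun J : Disorder n p => hamiltonian J σ := (continuous_hamiltonian σ).measurable

theorem hamiltonian_add_smul {n p : ℕ} (J J' : Disorder n p) (x y : ℝ) (σ : Config n) :
    hamiltonian (x • J + y • J') σ = x * hamiltonian J σ + y * hamiltonian J' σ := by
  simp only [hamiltonian, Pi.add_apply, Pi.smul_apply, smul_eq_mul, Finset.mul_sum]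
  rw [← Finset.sum_add_distrib]
  refine Finset.sum_congr rfl fun i _ => ?_
  ring

/-! ### Algebra of spins and overlaps -/

theorem spin_mul {n : ℕ} (σ τ : Config n) (i : Fin n) :
    spin (σ * τ) i = spin σ i * spin τ i := by
  simp [spin]

theorem spin_sq {n : ℕ} (σ : Config n) (i : Fin n) : spin σ i * spin σ i = 1 := by
  rcases Int.units_eq_one_or (σ i) with h | h <;> simp [spin, h]

theorem overlap_self {n : ℕ} (hn : n ≠ 0) (σ : Config n) : overlap σ σ = 1 := by
  simp [overlap, spin_sq, hn]

theorem overlap_comm {n : ℕ} (σ τ : Config n) : overlap σ τ = overlap τ σ := by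
  simp [overlap, mul_comm]

theorem overlap_mul_left {n : ℕ} (σ v w : Config n) :
    overlap (σ * v) (σ * w) = overlap v w := by
  unfold overlap
  congr 1
  refine Finset.sum_congr rfl fun i _ => ?_
  rw [spin_mul, spin_mul, mul_mul_mul_comm, spin_sq, one_mul]


/-! ### Large deviations for one tuple of configurations -/

theorem measureReal_le_integral {Ω : Type*} [MeasurableSpace Ω] {μ : Measure Ω}
    [IsFiniteMeasure μ] {s : Set Ω} (hs : MeasurableSet s) {f : Ω → ℝ} (hf : Integrable f μ)
    (h0 : ∀ x, 0 ≤ f x) (h1 : ∀ x ∈ s, 1 ≤ f x) : μ.real s ≤ ∫ x, f x ∂μ := by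
  rw [← integral_indicator_one hs]
  refine integral_mono ((integrable_const (1 : ℝ)).indicator hs) hf fun x => ?_
  by_cases hx : x ∈ s
  · simpa [hx] using h1 x hx
  · simpa [hx] using h0 x

theorem integral_le_measureReal {Ω : Type*} [MeasurableSpace Ω] {μ : Measure Ω}
    [IsFiniteMeasure μ] {s : Set Ω} (hs : MeasurableSet s) {f : Ω → ℝ} (hf : Integrable f μ)
    (h0 : ∀ x ∉ s, f x ≤ 0) (h1 : ∀ x ∈ s, f x ≤ 1) : ∫ x, f x ∂μ ≤ μ.real s := by
  rw [← integral_indicator_one hs]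
  refine integral_mono hf ((integrable_const (1 : ℝ)).indicator hs) fun x => ?_
  by_cases hx : x ∈ s
  · simpa [hx] using h1 x hx
  · simpa [hx] using h0 x hx

theorem measurableSet_forall_le_hamiltonian {n p : ℕ} {ι : Type*} [Fintype ι]
    (σ : ι → Config n) (b : ℝ) :
    MeasurableSet {J : Disorder n p | ∀ t, b ≤ hamiltonian J (σ t)} := by
  rw [Set.ofPred_forall]
  exact MeasurableSet.iInter fun t => measurableSet_le measurable_const (measurable_hamiltonian _)

theorem row_sum_le {n p : ℕ} (hn : n ≠ 0) {ι : Type*} [Fintype ι] (σ : ι → Config n) {κ : ℝ}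
    (hκ : 0 ≤ κ) (h : ∀ t s, t ≠ s → |overlap (σ t) (σ s)| ^ p ≤ κ) (t : ι) :
    ∑ s, overlap (σ t) (σ s) ^ p ≤ 1 + Fintype.card ι * κ := by
  classical
  have : ∀ s ∈ Finset.univ,
      overlap (σ t) (σ s) ^ p ≤ (if t = s then 1 else 0) + κ := fun s _ => by
    split_ifs with hts
    · subst hts; simpa [overlap_self hn] using hκ
    · have := h t s hts
      rw [← abs_pow] at this
      linarith [le_abs_self (overlap (σ t) (σ s) ^ p)]
  refine (Finset.sum_le_sum this).trans ?_
  simp [Finset.sum_add_distrib]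

theorem le_row_sum {n p : ℕ} (hn : n ≠ 0) {ι : Type*} [Fintype ι] (σ : ι → Config n) {κ : ℝ}
    (hκ : 0 ≤ κ) (h : ∀ t s, t ≠ s → |overlap (σ t) (σ s)| ^ p ≤ κ) (t : ι) :
    1 - Fintype.card ι * κ ≤ ∑ s, overlap (σ t) (σ s) ^ p := by
  classical
  have : ∀ s ∈ Finset.univ,
      (if t = s then 1 else 0) - κ ≤ overlap (σ t) (σ s) ^ p := fun s _ => by
    split_ifs with hts
    · subst hts; simpa [overlap_self hn] using hκ
    · have := h t s hts
      rw [← abs_pow] at this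
      linarith [neg_abs_le (overlap (σ t) (σ s) ^ p)]
  refine le_trans ?_ (Finset.sum_le_sum this)
  simp [Finset.sum_sub_distrib]

theorem sum_overlap_pow_le {n p : ℕ} (hn : n ≠ 0) {ι : Type*} [Fintype ι] (σ : ι → Config n)
    {κ : ℝ} (hκ : 0 ≤ κ) (h : ∀ t s, t ≠ s → |overlap (σ t) (σ s)| ^ p ≤ κ) :
    ∑ t, ∑ s, overlap (σ t) (σ s) ^ p ≤ Fintype.card ι * (1 + Fintype.card ι * κ) := by
  refine (Finset.sum_le_sum fun t _ => row_sum_le hn σ hκ h t).trans_eq ?_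
  simp [mul_add]

/-- Chernoff bound for the probability that all members of a tuple of configurations with small
pairwise correlations have large energy. -/
theorem measureReal_forall_le_hamiltonian_le {n p : ℕ} (hn : n ≠ 0) {ι : Type*} [Fintype ι]
    (σ : ι → Config n) {b κ : ℝ} (hb : 0 ≤ b) (hκ : 0 ≤ κ)
    (h : ∀ t s, t ≠ s → |overlap (σ t) (σ s)| ^ p ≤ κ) :
    (disorderLaw n p).real {J | ∀ t, b ≤ hamiltonian J (σ t)} ≤
      exp (n * (b ^ 2 * (Fintype.card ι * (Fintype.card ι * κ - 1)) / 2)) := by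
  have hf := (integrable_exp_sum_hamiltonian (p := p) σ fun _ => b).const_mul
    (exp (-(n * (Fintype.card ι * b ^ 2))))
  refine (measureReal_le_integral (measurableSet_forall_le_hamiltonian σ b) hf
    (fun _ => by positivity) fun J hJ => ?_).trans ?_
  · rw [← exp_add, one_le_exp_iff]
    have : ∑ _t : ι, b * b ≤ ∑ t, b * hamiltonian J (σ t) :=
      Finset.sum_le_sum fun t _ => mul_le_mul_of_nonneg_left (hJ t) hb
    have h2 := mul_le_mul_of_nonneg_left this (Nat.cast_nonneg (α := ℝ) n)
    simp only [Finset.sum_const, Finset.card_univ, nsmul_eq_mul] at h2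
    linarith
  · rw [integral_const_mul, integral_exp_sum_hamiltonian hn, ← exp_add, exp_le_exp]
    simp_rw [← Finset.mul_sum]
    have := mul_le_mul_of_nonneg_left (sum_overlap_pow_le hn σ hκ h)
      (show 0 ≤ (n : ℝ) / 2 * (b * b) by positivity)
    linarith

theorem measureReal_hamiltonian_le_neg_le {n p : ℕ} (hn : n ≠ 0) (σ : Config n) {x : ℝ}
    (hx : 0 ≤ x) :
    (disorderLaw n p).real {J | hamiltonian J σ ≤ -x} ≤ exp (-(n * (x ^ 2 / 2))) := by
  have hf := (integrable_exp_sum_hamiltonian (p := p) (fun _ : Unit => σ) fun _ => -x).const_mul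
    (exp (-(n * x ^ 2)))
  refine (measureReal_le_integral (measurableSet_le (measurable_hamiltonian σ) measurable_const) hf
    (fun _ => by positivity) fun J hJ => ?_).trans ?_
  · rw [← exp_add, one_le_exp_iff]
    have := mul_le_mul_of_nonneg_left (Set.mem_ofPred.1 hJ) hx
    have h2 := mul_le_mul_of_nonneg_left this (Nat.cast_nonneg (α := ℝ) n)
    simp only [Finset.univ_unique, Finset.sum_const, Finset.card_singleton, one_smul]
    linarith
  · rw [integral_const_mul, integral_exp_sum_hamiltonian hn, ← exp_add, exp_le_exp]
    simp [overlap_self hn]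
    linarith

/-- This evaluates the covariance form at a constant tilt `l` lowered by `s` in the single
coordinate `u`, the tilt produced when testing whether member `u` falls short. -/
theorem sum_sum_single_perturbation {ι : Type*} [Fintype ι] [DecidableEq ι] (R : ι → ι → ℝ)
    (hR : ∀ t s, R t s = R s t) (l s : ℝ) (u : ι) :
    ∑ t, ∑ t', (l - if t = u then s else 0) * (l - if t' = u then s else 0) * R t t' =
      l ^ 2 * (∑ t, ∑ t', R t t') - 2 * l * s * (∑ t, R u t) + s ^ 2 * R u u := by
  have h : ∀ t t', (l - if t = u then s else 0) * (l - if t' = u then s else 0) * R t t' =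
      l ^ 2 * R t t' - l * s * (if t = u then R t t' else 0)
        - l * s * (if t' = u then R t t' else 0)
        + s ^ 2 * (if t = u then (if t' = u then R t t' else 0) else 0) := by
    intro t t'; split_ifs <;> ring
  simp_rw [h, Finset.sum_add_distrib, Finset.sum_sub_distrib, ← Finset.mul_sum]
  simp only [Finset.sum_ite_irrel, Finset.sum_const_zero, Finset.sum_ite_eq', Finset.mem_univ,
    if_true]
  have : ∑ t, R t u = ∑ t, R u t := Finset.sum_congr rfl fun t _ => hR t u
  rw [this]; ring

/-- A reverse Chernoff bound, obtained by exponential tilting. -/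
theorem le_measureReal_forall_le_hamiltonian {n p : ℕ} (hn : n ≠ 0) {ι : Type*} [Fintype ι]
    (σ : ι → Config n) {b δ V : ℝ} (hb : 0 ≤ b) (hδ : 0 < δ)
    (hrow : ∀ t, b + δ ≤ (b + 2 * δ) * ∑ s, overlap (σ t) (σ s) ^ p)
    (hV : ∑ t, ∑ s, overlap (σ t) (σ s) ^ p = V) :
    exp (-(n * ((b + 2 * δ) ^ 2 * V / 2 + (b + 2 * δ) * δ * (V + 1) / 2))) *
        (1 - (Fintype.card ι + 1) * exp (-(n * (δ ^ 2 / 2)))) ≤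
      (disorderLaw n p).real {J | ∀ t, b ≤ hamiltonian J (σ t)} := by
  classical
  set l := b + 2 * δ with hl
  have hl0 : 0 < l := by positivity
  -- Under the tilt by `l`, the total energy has mean `l V` and member `u` has mean `l` times its
  -- row sum, at least `b + δ`. The cap `C` is chosen so that exceeding it costs exactly `exp (-n δ²
  -- / 2)` in the exponential bound.
  set C := V * (l + δ / 2) + δ / 2 with hC
  have hn0 : (0 : ℝ) < n := by positivity
  let G : (ι → ℝ) → Disorder n p → ℝ := fun c J => exp (n * ∑ t, c t * hamiltonian J (σ t))
  have hG : ∀ c, Integrable (G c) (disorderLaw n p) := fun c =>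
    integrable_exp_sum_hamiltonian σ c
  let cu : ι → ι → ℝ := fun u t => l - if t = u then δ else 0
  -- A minorant of the indicator of the event: the tilted density normalised at total energy `C`,
  -- minus exponential penalties for each member below `b` and for a total above `C`. A violated
  -- constraint makes its penalty dominate, so `f ≤ 0`; otherwise the density factor is at most `1`.
  let f : Disorder n p → ℝ := fun J => exp (-(n * (l * C))) * G (fun _ => l) J
    - ∑ u, exp (-(n * (l * C)) + n * (δ * b)) * G (cu u) J
    - exp (-(n * (l * C)) - n * (δ * C)) * G (fun _ => l + δ) J
  have hi1 : Integrable (fun J => exp (-(n * (l * C))) * G (fun _ => l) J) (disorderLaw n p) :=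
    (hG _).const_mul _
  have hi2 : Integrable (fun J => ∑ u, exp (-(n * (l * C)) + n * (δ * b)) * G (cu u) J)
      (disorderLaw n p) := integrable_finsetSum _ fun u _ => (hG _).const_mul _
  have hi3 : Integrable (fun J => exp (-(n * (l * C)) - n * (δ * C)) * G (fun _ => l + δ) J)
      (disorderLaw n p) := (hG _).const_mul _
  have hf : Integrable f (disorderLaw n p) := (hi1.sub hi2).sub hi3
  have hfac : ∀ J, f J = exp (n * (l * (∑ t, hamiltonian J (σ t) - C))) *
      (1 - ∑ u, exp (n * (δ * (b - hamiltonian J (σ u))))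
        - exp (n * (δ * (∑ t, hamiltonian J (σ t) - C)))) := by
    intro J
    have hcu : ∀ u, ∑ t, cu u t * hamiltonian J (σ t) =
        l * ∑ t, hamiltonian J (σ t) - δ * hamiltonian J (σ u) := fun u => by
      simp [cu, sub_mul, Finset.sum_sub_distrib, Finset.mul_sum]
    simp only [f, G, hcu, ← Finset.mul_sum]
    generalize ∑ t, hamiltonian J (σ t) = T
    simp only [mul_sub (exp _), mul_one, Finset.mul_sum, ← exp_add]
    congr 1
    · congr 1
      · congr 1; ring
      · refine Finset.sum_congr rfl fun u _ => ?_
        congr 1; ring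
    · congr 1; ring
  refine le_trans ?_ (integral_le_measureReal (measurableSet_forall_le_hamiltonian σ b) hf
    (fun J hJ => ?_) fun J hJ => ?_)
  · have hint : ∫ J, f J ∂(disorderLaw n p) = exp (-(n * (l * C))) * exp (n / 2 * (l ^ 2 * V))
        - ∑ u, exp (-(n * (l * C)) + n * (δ * b)) * exp (n / 2 *
            (l ^ 2 * V - 2 * l * δ * (∑ s, overlap (σ u) (σ s) ^ p) + δ ^ 2))
        - exp (-(n * (l * C)) - n * (δ * C)) * exp (n / 2 * ((l + δ) ^ 2 * V)) := by
      rw [show f = fun J => _ from rfl, integral_sub (by exact hi1.sub hi2) hi3,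
        integral_sub hi1 hi2,
        integral_finsetSum _ fun u _ => (hG _).const_mul _]
      simp only [integral_const_mul, G, cu]
      simp only [integral_exp_sum_hamiltonian hn]
      simp_rw [sum_sum_single_perturbation (fun t s => overlap (σ t) (σ s) ^ p)
        (fun t s => by rw [overlap_comm]), ← Finset.mul_sum, hV, overlap_self hn, one_pow, mul_one,
        ← sq]
    rw [hint]
    have e1 : exp (-(n * (l * C))) * exp (n / 2 * (l ^ 2 * V)) =
        exp (-(n * (l ^ 2 * V / 2 + l * δ * (V + 1) / 2))) := by
      rw [← exp_add]; congr 1; rw [hC]; ring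
    have e3 : exp (-(n * (l * C)) - n * (δ * C)) * exp (n / 2 * ((l + δ) ^ 2 * V)) =
        exp (-(n * (l ^ 2 * V / 2 + l * δ * (V + 1) / 2))) * exp (-(n * (δ ^ 2 / 2))) := by
      rw [← exp_add, ← exp_add]; congr 1; rw [hC]; ring
    have e2 : ∀ u ∈ Finset.univ, exp (-(n * (l * C)) + n * (δ * b)) * exp (n / 2 *
            (l ^ 2 * V - 2 * l * δ * (∑ s, overlap (σ u) (σ s) ^ p) + δ ^ 2)) ≤
        exp (-(n * (l ^ 2 * V / 2 + l * δ * (V + 1) / 2))) * exp (-(n * (δ ^ 2 / 2))) := by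
      intro u _
      rw [← exp_add, ← exp_add, exp_le_exp]
      have := mul_le_mul_of_nonneg_left (hrow u) (show 0 ≤ n * δ by positivity)
      rw [hC]
      linarith
    have e2' := Finset.sum_le_sum e2
    rw [Finset.sum_const, Finset.card_univ, nsmul_eq_mul] at e2'
    rw [e1, e3]
    linarith
  · rw [hfac]
    refine mul_nonpos_of_nonneg_of_nonpos (exp_nonneg _) ?_
    simp only [Set.mem_ofPred_eq, not_forall, not_le] at hJ
    obtain ⟨u, hu⟩ := hJ
    have h1 : 1 ≤ exp (n * (δ * (b - hamiltonian J (σ u)))) :=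
      one_le_exp (by have := sub_pos.2 hu; positivity)
    have h2 := Finset.single_le_sum (f := fun u => exp (n * (δ * (b - hamiltonian J (σ u)))))
      (fun i _ => exp_nonneg _) (Finset.mem_univ u)
    have h3 := exp_nonneg (n * (δ * (∑ t, hamiltonian J (σ t) - C)))
    linarith
  · rw [hfac]
    have h2 : 0 ≤ ∑ u, exp (n * (δ * (b - hamiltonian J (σ u)))) :=
      Finset.sum_nonneg fun _ _ => exp_nonneg _
    have h3 := exp_nonneg (n * (δ * (∑ t, hamiltonian J (σ t) - C)))
    rcases le_or_gt (∑ t, hamiltonian J (σ t)) C with hT | hT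
    · have h1 : exp (n * (l * (∑ t, hamiltonian J (σ t) - C))) ≤ 1 :=
        exp_le_one_iff.2 (mul_nonpos_of_nonneg_of_nonpos hn0.le
          (mul_nonpos_of_nonneg_of_nonpos hl0.le (sub_nonpos.2 hT)))
      exact (mul_le_of_le_one_right (exp_nonneg _) (by linarith)).trans h1
    · have h1 : 1 ≤ exp (n * (δ * (∑ t, hamiltonian J (σ t) - C))) :=
        one_le_exp (by have := sub_pos.2 hT; positivity)
      refine (mul_nonpos_of_nonneg_of_nonpos (exp_nonneg _) ?_).trans zero_le_one
      linarith

theorem exists_le_measureReal_forall_le_hamiltonian (m : ℕ) {b ε : ℝ} (hb : 0 ≤ b) (hε : 0 < ε) :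
    ∃ κ : ℝ, 0 < κ ∧ ∃ N : ℕ, ∀ n ≥ N, ∀ p, ∀ σ : Fin m → Config n,
      (∀ t s, t ≠ s → |overlap (σ t) (σ s)| ^ p ≤ κ) →
      exp (-(n * (m * b ^ 2 / 2 + ε))) / 2 ≤
        (disorderLaw n p).real {J | ∀ t, b ≤ hamiltonian J (σ t)} := by
  let F : ℝ → ℝ := fun δ => (b + 2 * δ) ^ 2 * (m * (1 + δ)) / 2 +
    (b + 2 * δ) * δ * (m * (1 + δ) + 1) / 2
  have hF : Continuous F := by fun_prop
  obtain ⟨δ, hδF, hδ⟩ : ∃ δ, F δ < m * b ^ 2 / 2 + ε ∧ 0 < δ := by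
    have h0 : F 0 < m * b ^ 2 / 2 + ε := by simp only [F]; nlinarith
    have h1 : ∀ᶠ δ in nhdsWithin (0 : ℝ) (Set.Ioi 0), F δ < m * b ^ 2 / 2 + ε :=
      (hF.continuousAt.eventually_lt continuousAt_const h0).filter_mono nhdsWithin_le_nhds
    exact (h1.and self_mem_nhdsWithin).exists
  -- One choice serves two needs: `m κ ≤ δ` bounds the total covariance by `m (1 + δ)`, and `(b + 2
  -- δ) m κ ≤ δ` gives the row-sum condition of the tilting bound.
  set κ := δ / ((m + 1) * (b + 2 * δ + 1)) with hκdef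
  have hκ : 0 < κ := by positivity
  have hmκ : m * κ * (b + 2 * δ + 1) ≤ δ := by
    have : (m + 1) * κ * (b + 2 * δ + 1) = δ := by rw [hκdef]; field_simp
    have : 0 ≤ κ * (b + 2 * δ + 1) := by positivity
    linarith
  have h3 : 0 ≤ m * κ := by positivity
  have hmκ1 : m * κ ≤ δ := by
    have : 0 ≤ m * κ * (b + 2 * δ) := by positivity
    linarith
  obtain ⟨N, hN⟩ : ∃ N : ℕ, ∀ n ≥ N, ((m : ℝ) + 1) * exp (-(n * (δ ^ 2 / 2))) ≤ 1 / 2 := by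
    have : Filter.Tendsto (fun n : ℕ => ((m : ℝ) + 1) * exp (-(n * (δ ^ 2 / 2)))) Filter.atTop
        (nhds (((m : ℝ) + 1) * 0)) :=
      ((tendsto_exp_neg_atTop_nhds_zero.comp
        (tendsto_natCast_atTop_atTop.atTop_mul_const (by positivity))).const_mul _)
    rw [mul_zero] at this
    exact Filter.eventually_atTop.1 (this.eventually_le_const (by norm_num))
  refine ⟨κ, hκ, max N 1, fun n hn p σ hσ => ?_⟩
  have hn0 : n ≠ 0 := by have := le_of_max_le_right hn; omega
  have hVle := sum_overlap_pow_le hn0 σ hκ.le hσ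
  rw [Fintype.card_fin] at hVle
  refine le_trans ?_ (le_measureReal_forall_le_hamiltonian hn0 σ hb hδ (fun t => ?_) rfl)
  · rw [Fintype.card_fin, div_eq_mul_one_div]
    refine mul_le_mul ?_ (by linarith [hN n (le_of_max_le_left hn)]) (by norm_num) (exp_nonneg _)
    rw [exp_le_exp, neg_le_neg_iff]
    refine mul_le_mul_of_nonneg_left (le_trans ?_ hδF.le) (Nat.cast_nonneg n)
    have hV2 : ∑ t, ∑ s, overlap (σ t) (σ s) ^ p ≤ m * (1 + δ) :=
      hVle.trans (by gcongr)
    simp only [F]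
    gcongr
  · have := le_row_sum hn0 σ hκ.le hσ t
    rw [Fintype.card_fin] at this
    have h2 := mul_le_mul_of_nonneg_left this (show 0 ≤ b + 2 * δ by positivity)
    linarith


/-! ### Counting nearby configurations and building overlap patterns -/

theorem natCast_mul_overlap {n : ℕ} (σ τ : Config n) :
    n * overlap σ τ = ∑ i, spin σ i * spin τ i := by
  rcases eq_or_ne n 0 with rfl | hn
  · simp
  · simp [overlap, hn]

theorem overlap_neg_right {n : ℕ} (σ τ : Config n) : overlap σ (-τ) = -overlap σ τ := by
  simp [overlap, spin]

theorem overlap_mul_right {n : ℕ} (σ τ v : Config n) :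
    overlap σ (τ * v) = overlap (σ * v) τ := by
  simp_rw [overlap, spin_mul]
  congr 1
  exact Finset.sum_congr rfl fun i _ => by ring

theorem sum_exp_overlap {n : ℕ} (β : ℝ) (τ : Config n) :
    ∑ σ : Config n, exp (β * (n * overlap σ τ)) = (exp β + exp (-β)) ^ n := by
  simp_rw [natCast_mul_overlap, Finset.mul_sum, exp_sum]
  have := Fintype.prod_sum fun (i : Fin n) (u : ℤˣ) => exp (β * (((u : ℤ) : ℝ) * spin τ i))
  simp only [spin] at this ⊢
  rw [← this]
  have h : ∀ i ∈ Finset.univ, ∑ u : ℤˣ, exp (β * (((u : ℤ) : ℝ) * spin τ i)) =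
      exp β + exp (-β) := fun i _ => by
    rcases Int.units_eq_one_or (τ i) with h | h <;> simp [spin, h, add_comm]
  simpa [spin] using Finset.prod_congr rfl h

theorem card_overlap_gt_le {n : ℕ} {h : ℝ} (hh : 0 < h) (τ : Config n) :
    ((Finset.univ.filter fun σ : Config n => 1 - h ^ 2 / 2 < overlap σ τ).card : ℝ) ≤
      exp (n * h) := by
  -- With `β = 1 / h`, the threshold contributes `β h² / 2 = h / 2`, and `exp (-2 β) ≤ h / 2` gives
  -- `exp β + exp (-β) ≤ exp (β + h / 2)`. Together these cost `exp h` per coordinate.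
  set β := 1 / h with hβ
  have hβ0 : 0 < β := by positivity
  calc ((Finset.univ.filter fun σ : Config n => 1 - h ^ 2 / 2 < overlap σ τ).card : ℝ)
      = ∑ σ : Config n, if 1 - h ^ 2 / 2 < overlap σ τ then (1 : ℝ) else 0 := by simp
    _ ≤ ∑ σ : Config n, exp (-(β * (n * (1 - h ^ 2 / 2)))) * exp (β * (n * overlap σ τ)) := by
        refine Finset.sum_le_sum fun σ _ => ?_
        split_ifs with hσ
        · rw [← exp_add, one_le_exp_iff]
          have := mul_le_mul_of_nonneg_left hσ.le (show 0 ≤ β * n by positivity)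
          linarith
        · positivity
    _ = (exp (-(β * (1 - h ^ 2 / 2))) * (exp β + exp (-β))) ^ n := by
        rw [← Finset.mul_sum, sum_exp_overlap, mul_pow, ← exp_nat_mul]
        congr 2; ring
    _ ≤ exp h ^ n := by
        gcongr
        have h1 : exp (-(2 * β)) ≤ h / 2 := by
          rw [exp_neg, inv_le_comm₀ (exp_pos _) (by positivity)]
          have := add_one_le_exp (2 * β)
          have h2 : (h / 2)⁻¹ = 2 * β := by rw [hβ]; field_simp
          linarith
        have h2 : exp β + exp (-β) ≤ exp (β + h / 2) := by
          have : exp (-β) = exp β * exp (-(2 * β)) := by rw [← exp_add]; congr 1; ring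
          rw [exp_add, this]
          have := add_one_le_exp (h / 2)
          have := exp_pos β
          nlinarith
        refine (mul_le_mul_of_nonneg_left h2 (exp_nonneg _)).trans ?_
        rw [← exp_add, exp_le_exp]
        have : β * h = 1 := by rw [hβ]; field_simp
        have : β * (h ^ 2 / 2) = h / 2 := by rw [sq, mul_div_assoc, ← mul_assoc, this, one_mul]
        linarith
    _ = exp (n * h) := by rw [← exp_nat_mul]

theorem card_abs_overlap_gt_le {n : ℕ} {h : ℝ} (hh : 0 < h) (τ : Config n) :
    ((Finset.univ.filter fun σ : Config n => 1 - h ^ 2 / 2 < |overlap σ τ|).card : ℝ) ≤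
      2 * exp (n * h) := by
  have hsub : (Finset.univ.filter fun σ : Config n => 1 - h ^ 2 / 2 < |overlap σ τ|) ⊆
      (Finset.univ.filter fun σ : Config n => 1 - h ^ 2 / 2 < overlap σ τ) ∪
      (Finset.univ.filter fun σ : Config n => 1 - h ^ 2 / 2 < overlap σ (-τ)) := fun σ hσ => by
    simpa [overlap_neg_right, lt_abs] using hσ
  have := (Finset.card_le_card hsub).trans (Finset.card_union_le _ _)
  have h' : ((Finset.univ.filter fun σ : Config n => 1 - h ^ 2 / 2 < |overlap σ τ|).card : ℝ) ≤
      (Finset.univ.filter fun σ : Config n => 1 - h ^ 2 / 2 < overlap σ τ).card +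
      (Finset.univ.filter fun σ : Config n => 1 - h ^ 2 / 2 < overlap σ (-τ)).card := by
    exact_mod_cast this
  linarith [card_overlap_gt_le hh τ, card_overlap_gt_le hh (-τ)]

/-- Flipping the sign of coordinate `t` permutes the cube and negates every summand. -/
theorem sum_units_mul_units {m : ℕ} {t l : Fin m} (htl : t ≠ l) :
    ∑ x : Fin m → ℤˣ, (((x t : ℤ) : ℝ) * ((x l : ℤ) : ℝ)) = 0 := by
  have h : ∑ x : Fin m → ℤˣ, (((x t : ℤ) : ℝ) * ((x l : ℤ) : ℝ)) =
      ∑ x : Fin m → ℤˣ, -(((x t : ℤ) : ℝ) * ((x l : ℤ) : ℝ)) := by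
    refine Fintype.sum_equiv (Equiv.mulLeft (Function.update (1 : Fin m → ℤˣ) t (-1))) _ _
      fun x => ?_
    simp [Function.update_of_ne htl.symm]
  rw [Finset.sum_neg_distrib] at h
  linarith

/-- On a set made of `q` copies of the cube and `r` further points, Walsh patterns on the cubes give
`m` configurations whose pairwise overlaps are exactly `r / n`. -/
theorem exists_config_overlap_eq (m q r : ℕ) {n : ℕ} (hn : q * 2 ^ m + r = n) :
    ∃ v : Fin m → Config n, ∀ t l, t ≠ l → overlap (v t) (v l) = r / n := by
  have hcard : Fintype.card (Fin n) = Fintype.card ((Fin q × (Fin m → ℤˣ)) ⊕ Fin r) := by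
    simp [hn]
  let e := Fintype.equivOfCardEq hcard
  refine ⟨fun t i => Sum.elim (fun x => x.2 t) (fun _ => 1) (e i), fun t l htl => ?_⟩
  have : ∑ i, spin (fun i => Sum.elim (fun x => x.2 t) (fun _ => 1) (e i) : Config n) i *
      spin (fun i => Sum.elim (fun x => x.2 l) (fun _ => 1) (e i) : Config n) i = r := by
    simp only [spin]
    rw [e.sum_comp fun y => (((Sum.elim (fun x => x.2 t) (fun _ => 1) y : ℤˣ) : ℤ) : ℝ) *
      (((Sum.elim (fun x => x.2 l) (fun _ => 1) y : ℤˣ) : ℤ) : ℝ)]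
    simp [Fintype.sum_prod_type, sum_units_mul_units htl]
  rw [overlap, this, div_eq_inv_mul]

theorem exists_config_overlap_mem_Icc (m : ℕ) {ξ η : ℝ} (hη : 0 < η) (hηξ : η < ξ) (hξ : ξ < 1) :
    ∃ N : ℕ, ∀ n ≥ N, ∃ v : Fin m → Config n,
      ∀ t l, t ≠ l → overlap (v t) (v l) ∈ Set.Icc (ξ - η) ξ := by
  refine ⟨⌈2 ^ m / η⌉₊ + 1, fun n hn => ?_⟩
  have hn1 : 2 ^ m / η ≤ n := (Nat.le_ceil _).trans (by exact_mod_cast (Nat.le_succ _).trans hn)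
  have hn0 : (0 : ℝ) < n := by
    have : 0 < n := by omega
    exact_mod_cast this
  rw [div_le_iff₀ hη] at hn1
  -- Taking `⌊x⌋₊` cubes leaves a remainder `r ≥ (ξ - η) n`; rounding down adds at most `2 ^ m` to
  -- it, and `2 ^ m ≤ η n` keeps `r / n ≤ ξ`.
  set x : ℝ := (1 - (ξ - η)) * n / 2 ^ m with hx
  have hx0 : 0 ≤ x := by
    have : 0 ≤ 1 - (ξ - η) := by linarith
    positivity
  have h2 : (0 : ℝ) < 2 ^ m := by positivity
  have hx1 : x * 2 ^ m = (1 - (ξ - η)) * n := by rw [hx]; field_simp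
  have hq1 : (⌊x⌋₊ : ℝ) * 2 ^ m ≤ x * 2 ^ m := by gcongr; exact Nat.floor_le hx0
  have hq2 : x * 2 ^ m ≤ (⌊x⌋₊ + 1 : ℝ) * 2 ^ m := by gcongr; exact (Nat.lt_floor_add_one x).le
  have hle : ⌊x⌋₊ * 2 ^ m ≤ n := by
    have : (⌊x⌋₊ : ℝ) * 2 ^ m ≤ n := by nlinarith
    exact_mod_cast this
  obtain ⟨v, hv⟩ := exists_config_overlap_eq m ⌊x⌋₊ (n - ⌊x⌋₊ * 2 ^ m)
    (Nat.add_sub_cancel' hle)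
  refine ⟨v, fun t l htl => ?_⟩
  rw [hv t l htl, Nat.cast_sub hle, Set.mem_Icc, le_div_iff₀ hn0, div_le_iff₀ hn0]
  push_cast
  constructor <;> linarith


/-! ### Second moment bound at exponential scale -/

/-- The second moment method for a finite family of events. -/
theorem sq_sum_measureReal_le {Ω S : Type*} [MeasurableSpace Ω] {μ : Measure Ω}
    [IsFiniteMeasure μ] [Fintype S] {A : S → Set Ω} (hA : ∀ s, MeasurableSet (A s)) :
    (∑ s, μ.real (A s)) ^ 2 ≤ μ.real (⋃ s, A s) * ∑ s, ∑ s', μ.real (A s ∩ A s') := by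
  have hU : MeasurableSet (⋃ s, A s) := MeasurableSet.iUnion hA
  have hind : ∀ B : Set Ω, MeasurableSet B → Integrable (B.indicator (1 : Ω → ℝ)) μ :=
    fun B hB => (integrable_const (1 : ℝ)).indicator hB
  -- With `Z` the number of events that occur and `U` their union, this is `E (Z - x 1_U)² ≥ 0`, a
  -- quadratic in `x` because `Z 1_U = Z`. Its discriminant is therefore nonpositive.
  have key : ∀ x : ℝ, 0 ≤ μ.real (⋃ s, A s) * (x * x) + (-2 * ∑ s, μ.real (A s)) * x +
      ∑ s, ∑ s', μ.real (A s ∩ A s') := by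
    intro x
    have hpt : ∀ ω, (∑ s, (A s).indicator (1 : Ω → ℝ) ω - x * (⋃ s, A s).indicator 1 ω) ^ 2 =
        (x * x) * (⋃ s, A s).indicator (1 : Ω → ℝ) ω +
          (-2 * x) * ∑ s, (A s).indicator (1 : Ω → ℝ) ω +
          ∑ s, ∑ s', (A s ∩ A s').indicator (1 : Ω → ℝ) ω := by
      intro ω
      have h1 : ∑ s, ∑ s', (A s ∩ A s').indicator (1 : Ω → ℝ) ω =
          (∑ s, (A s).indicator (1 : Ω → ℝ) ω) * ∑ s, (A s).indicator (1 : Ω → ℝ) ω := by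
        rw [Finset.sum_mul_sum]
        simp_rw [Set.inter_indicator_one, Pi.mul_apply]
      rw [h1]
      by_cases hω : ω ∈ ⋃ s, A s
      · simp only [Set.indicator_of_mem hω, Pi.one_apply]; ring
      · have : ∀ s, ω ∉ A s := fun s hs => hω (Set.mem_iUnion.2 ⟨s, hs⟩)
        simp [Set.indicator_of_notMem (this _), Set.indicator_of_notMem hω]
    have hnn : 0 ≤ ∫ ω, (∑ s, (A s).indicator (1 : Ω → ℝ) ω -
        x * (⋃ s, A s).indicator 1 ω) ^ 2 ∂μ := integral_nonneg fun _ => sq_nonneg _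
    simp_rw [hpt] at hnn
    rw [integral_add, integral_add, integral_const_mul, integral_const_mul,
      integral_indicator_one hU, integral_finsetSum _ fun s _ => hind _ (hA s),
      integral_finsetSum _ fun s _ => integrable_finsetSum _ fun s' _ =>
        hind _ ((hA s).inter (hA s'))] at hnn
    · simp_rw [integral_finsetSum _ fun s' _ => hind _ ((hA _).inter (hA s')),
        integral_indicator_one (hA _), integral_indicator_one ((hA _).inter (hA _))] at hnn
      linarith
    · exact (hind _ hU).const_mul _
    · exact (integrable_finsetSum _ fun s _ => hind _ (hA s)).const_mul _
    · exact ((hind _ hU).const_mul _).add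
        ((integrable_finsetSum _ fun s _ => hind _ (hA s)).const_mul _)
    · exact integrable_finsetSum _ fun s _ => integrable_finsetSum _ fun s' _ =>
        hind _ ((hA s).inter (hA s'))
  have := discrim_le_zero key
  rw [discrim] at this
  linarith

/-- Tuples of configurations with energies at least `b` and pairwise overlaps in `[ξ - η, ξ]`. -/
def tupleEvent (n p m : ℕ) (b ξ η : ℝ) : Set (Disorder n p) :=
  {J | ∃ σ : Fin m → Config n, (∀ t, b ≤ hamiltonian J (σ t)) ∧
    ∀ t l, t < l → overlap (σ t) (σ l) ∈ Set.Icc (ξ - η) ξ}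

theorem measurableSet_tupleEvent (n p m : ℕ) (b ξ η : ℝ) :
    MeasurableSet (tupleEvent n p m b ξ η) := by
  have : tupleEvent n p m b ξ η = ⋃ σ : Fin m → Config n,
      ⋃ _ : ∀ t l, t < l → overlap (σ t) (σ l) ∈ Set.Icc (ξ - η) ξ,
        {J | ∀ t, b ≤ hamiltonian J (σ t)} := by
    ext J; simp [tupleEvent, and_comm]
  rw [this]
  exact MeasurableSet.iUnion fun σ => MeasurableSet.iUnion fun _ =>
    measurableSet_forall_le_hamiltonian σ b

theorem card_config (n : ℕ) : Fintype.card (Config n) = 2 ^ n := by simp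

theorem overlap_mul_mul {n : ℕ} (σ τ v w : Config n) :
    overlap (σ * v) (τ * w) = overlap τ (σ * v * w) := by
  rw [overlap_mul_right, overlap_comm]

/-- Joint upper bound for two translates of a pattern all of whose mutual overlaps are at most `r`
in absolute value. -/
theorem measureReal_inter_le {n p m : ℕ} (hn : n ≠ 0) (v : Fin m → Config n) {b κ r : ℝ}
    (hb : 0 ≤ b) (hκ : 0 ≤ κ) (hrκ : r ^ p ≤ κ)
    (hv : ∀ t l, t ≠ l → |overlap (v t) (v l)| ≤ r) (σ τ : Config n)
    (hστ : ∀ t l, |overlap τ (σ * v t * v l)| ≤ r) :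
    (disorderLaw n p).real ({J | ∀ t, b ≤ hamiltonian J (σ * v t)} ∩
      {J | ∀ t, b ≤ hamiltonian J (τ * v t)}) ≤ exp (n * (b ^ 2 * m * (2 * m * κ - 1))) := by
  have h := measureReal_forall_le_hamiltonian_le (p := p) hn
    (Sum.elim (fun t => σ * v t) (fun t => τ * v t)) hb hκ ?_
  · refine le_trans (le_of_eq ?_) (h.trans (le_of_eq ?_))
    · congr 1; ext J; simp
    · simp; left; ring
  · have hp : ∀ x : ℝ, |x| ≤ r → |x| ^ p ≤ κ := fun x hx =>
      (pow_le_pow_left₀ (abs_nonneg _) hx p).trans hrκ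
    rintro (t | t) (l | l) htl
    · simpa [overlap_mul_left] using hp _ (hv t l (by simpa using htl))
    · simpa [overlap_mul_mul] using hp _ (hστ t l)
    · simpa [overlap_mul_mul, overlap_comm] using hp _ (hστ l t)
    · simpa [overlap_mul_left] using hp _ (hv t l (by simpa using htl))

/-- Pairs with all cross overlaps at most `1 - h² / 2` in absolute value get the joint bound for `2
m` configurations. For the others one event is dropped; for each `σ` at most `m ^ 2 * (2 * exp (n
h))` choices of `τ` are of this kind, by a union over the index pairs `(t, l)`. -/
theorem sum_measureReal_inter_le {n p m : ℕ} (hn : n ≠ 0) (v : Fin m → Config n)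
    {b κ r h : ℝ} (hb : 0 ≤ b) (hκ : 0 ≤ κ) (hrκ : r ^ p ≤ κ) (hh : 0 < h)
    (hr : 1 - h ^ 2 / 2 ≤ r) (hv : ∀ t l, t ≠ l → |overlap (v t) (v l)| ≤ r) :
    ∑ σ : Config n, ∑ τ : Config n,
      (disorderLaw n p).real ({J | ∀ t, b ≤ hamiltonian J (σ * v t)} ∩
        {J | ∀ t, b ≤ hamiltonian J (τ * v t)}) ≤
      2 ^ n * (2 ^ n * exp (n * (b ^ 2 * m * (2 * m * κ - 1))) +
        m ^ 2 * (2 * exp (n * h)) * exp (n * (b ^ 2 * (m * (m * κ - 1)) / 2))) := by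
  classical
  have hp : ∀ x : ℝ, |x| ≤ r → |x| ^ p ≤ κ := fun x hx =>
    (pow_le_pow_left₀ (abs_nonneg _) hx p).trans hrκ
  set U₂ := exp (n * (b ^ 2 * m * (2 * m * κ - 1)))
  set U₁ := exp (n * (b ^ 2 * (m * (m * κ - 1)) / 2))
  have hU₁ : 0 ≤ U₁ := exp_nonneg _
  have hU₂ : 0 ≤ U₂ := exp_nonneg _
  have hpair : ∀ σ τ : Config n,
      (disorderLaw n p).real ({J | ∀ t, b ≤ hamiltonian J (σ * v t)} ∩
        {J | ∀ t, b ≤ hamiltonian J (τ * v t)}) ≤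
      U₂ + ∑ t, ∑ l, if 1 - h ^ 2 / 2 < |overlap τ (σ * v t * v l)| then U₁ else 0 := by
    intro σ τ
    have hnn : ∀ t l, 0 ≤ if 1 - h ^ 2 / 2 < |overlap τ (σ * v t * v l)| then U₁ else 0 :=
      fun t l => by split_ifs <;> simp [hU₁]
    by_cases hst : ∀ t l, |overlap τ (σ * v t * v l)| ≤ 1 - h ^ 2 / 2
    · refine (measureReal_inter_le hn v hb hκ hrκ hv σ τ fun t l => (hst t l).trans hr).trans ?_
      exact le_add_of_nonneg_right (Finset.sum_nonneg fun t _ => Finset.sum_nonneg fun l _ =>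
        hnn t l)
    · push Not at hst
      obtain ⟨t, l, htl⟩ := hst
      have h1 : (disorderLaw n p).real ({J | ∀ t, b ≤ hamiltonian J (σ * v t)} ∩
          {J | ∀ t, b ≤ hamiltonian J (τ * v t)}) ≤ U₁ := by
        refine (measureReal_mono Set.inter_subset_left).trans ?_
        refine (measureReal_forall_le_hamiltonian_le hn (fun t => σ * v t) hb hκ
          fun t s hts => ?_).trans (le_of_eq ?_)
        · simpa [overlap_mul_left] using hp _ (hv t s hts)
        · simp [U₁]
      have h2 := Finset.single_le_sum
        (f := fun t => ∑ l, if 1 - h ^ 2 / 2 < |overlap τ (σ * v t * v l)| then U₁ else 0)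
        (s := Finset.univ) (fun t _ => Finset.sum_nonneg fun l _ => hnn t l)
        (Finset.mem_univ t)
      have h3 := Finset.single_le_sum (fun l _ => hnn t l) (Finset.mem_univ l)
      simp only [htl, if_true] at h3
      linarith
  have hrow : ∀ σ ∈ (Finset.univ : Finset (Config n)), ∑ τ : Config n,
      (disorderLaw n p).real ({J | ∀ t, b ≤ hamiltonian J (σ * v t)} ∩
        {J | ∀ t, b ≤ hamiltonian J (τ * v t)}) ≤
      2 ^ n * U₂ + m ^ 2 * (2 * exp (n * h)) * U₁ := by
    intro σ _
    refine (Finset.sum_le_sum fun τ _ => hpair σ τ).trans ?_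
    rw [Finset.sum_add_distrib, Finset.sum_const, Finset.card_univ, card_config, nsmul_eq_mul,
      Finset.sum_comm]
    push_cast
    gcongr
    have hbad : ∀ t l, ∑ τ : Config n,
        (if 1 - h ^ 2 / 2 < |overlap τ (σ * v t * v l)| then U₁ else 0) ≤
          2 * exp (n * h) * U₁ := fun t l => by
      rw [← Finset.sum_filter, Finset.sum_const, nsmul_eq_mul]
      gcongr
      exact card_abs_overlap_gt_le hh _
    have : ∑ t : Fin m, ∑ l : Fin m, 2 * exp (n * h) * U₁ = m ^ 2 * (2 * exp (n * h)) * U₁ := by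
      simp; ring
    rw [← this]
    refine Finset.sum_le_sum fun t _ => ?_
    rw [Finset.sum_comm]
    exact Finset.sum_le_sum fun l _ => hbad t l
  refine (Finset.sum_le_sum hrow).trans ?_
  rw [Finset.sum_const, Finset.card_univ, card_config, nsmul_eq_mul]
  push_cast
  rfl

theorem exists_le_measureReal_tupleEvent (m : ℕ) {b ξ η e : ℝ} (hb : 0 ≤ b)
    (hbm : m * b ^ 2 / 2 < log 2) (hη : 0 < η) (hηξ : η < ξ) (hξ : ξ < 1) (he : 0 < e) :
    ∃ Pstar : ℕ, ∀ p ≥ Pstar, ∃ C : ℝ, 0 < C ∧ ∃ N : ℕ, ∀ n ≥ N,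
      exp (-(n * e)) ≤ C * (disorderLaw n p).real (tupleEvent n p m b ξ η) := by
  set ε := min e (log 2 - m * b ^ 2 / 2) / 8 with hεdef
  have hε : 0 < ε := div_pos (lt_min he (sub_pos.2 hbm)) (by norm_num)
  have hεe : 4 * ε ≤ e := by
    have := min_le_left e (log 2 - m * b ^ 2 / 2)
    linarith
  have hεG : 8 * ε ≤ log 2 - m * b ^ 2 / 2 := by
    have := min_le_right e (log 2 - m * b ^ 2 / 2)
    linarith
  obtain ⟨κ₀, hκ₀, N₀, hN₀⟩ := exists_le_measureReal_forall_le_hamiltonian m hb hε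
  set κ := min κ₀ (ε / (m ^ 2 * b ^ 2 + 1)) with hκdef
  have hκ : 0 < κ := lt_min hκ₀ (by positivity)
  have hκε : m ^ 2 * b ^ 2 * κ ≤ ε := by
    have h1 : κ * (m ^ 2 * b ^ 2 + 1) ≤ ε :=
      (le_div_iff₀ (by positivity)).1 (min_le_right κ₀ (ε / (m ^ 2 * b ^ 2 + 1)))
    linarith
  -- `r < 1` dominates the overlaps inside the pattern (at most `ξ`) and the cross overlaps of the
  -- well-separated pairs. Taking `p` large then serves only to force `r ^ p ≤ κ`.
  set r := max (1 - ε ^ 2 / 2) ξ with hrdef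
  have hr1 : r < 1 := max_lt (by have := pow_pos hε 2; linarith) hξ
  have hξr : ξ ≤ r := le_max_right _ _
  have hr0 : 0 ≤ r := by linarith
  obtain ⟨P, hP⟩ := exists_pow_lt_of_lt_one hκ hr1
  obtain ⟨N₁, hN₁⟩ := exists_config_overlap_mem_Icc m hη hηξ hξ
  refine ⟨P, fun p hp => ⟨4 + 8 * m ^ 2, by positivity, max (max N₀ N₁) 1, fun n hn => ?_⟩⟩
  have hrκ : r ^ p ≤ κ := (pow_le_pow_of_le_one hr0 hr1.le hp).trans hP.le
  have hn0 : n ≠ 0 := by have := le_of_max_le_right hn; omega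
  obtain ⟨v, hv⟩ := hN₁ n ((le_max_right _ _).trans (le_of_max_le_left hn))
  have hvr : ∀ t l, t ≠ l → |overlap (v t) (v l)| ≤ r := fun t l htl => by
    have := hv t l htl
    rw [abs_of_nonneg (by linarith [this.1])]
    exact this.2.trans hξr
  set A : Config n → Set (Disorder n p) := fun σ => {J | ∀ t, b ≤ hamiltonian J (σ * v t)}
    with hAdef
  have hAm : ∀ σ, MeasurableSet (A σ) := fun σ =>
    measurableSet_forall_le_hamiltonian (fun t => σ * v t) b
  have hsub : (⋃ σ, A σ) ⊆ tupleEvent n p m b ξ η := fun J hJ => by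
    obtain ⟨σ, hσ⟩ := Set.mem_iUnion.1 hJ
    refine ⟨fun t => σ * v t, hσ, fun t l htl => ?_⟩
    rw [overlap_mul_left]
    exact hv t l htl.ne
  set q := exp (-(n * (m * b ^ 2 / 2 + ε))) / 2 with hq
  have hq0 : 0 < q := by positivity
  have hqA : ∀ σ ∈ Finset.univ, q ≤ (disorderLaw n p).real (A σ) := fun σ _ =>
    hN₀ n ((le_max_left _ _).trans (le_of_max_le_left hn)) p (fun t => σ * v t) fun t l htl => by
      rw [overlap_mul_left]
      exact (pow_le_pow_left₀ (abs_nonneg _) (hvr t l htl) p).trans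
        (hrκ.trans (min_le_left _ _))
  have hz : 2 ^ n * q ≤ ∑ σ, (disorderLaw n p).real (A σ) := by
    have := Finset.sum_le_sum hqA
    rwa [Finset.sum_const, Finset.card_univ, card_config, nsmul_eq_mul, Nat.cast_pow,
      Nat.cast_ofNat] at this
  have hW := sum_measureReal_inter_le hn0 v hb hκ.le hrκ hε (le_max_left _ _) hvr
  have hE2 : exp (n * (b ^ 2 * m * (2 * m * κ - 1))) ≤ 4 * q ^ 2 * exp (n * e) := by
    rw [hq, div_pow, ← exp_nat_mul, show 4 * (exp (((2 : ℕ) : ℝ) * -(n * (m * b ^ 2 / 2 + ε))) /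
      2 ^ 2) = exp (((2 : ℕ) : ℝ) * -(n * (m * b ^ 2 / 2 + ε))) by ring, ← exp_add, exp_le_exp]
    push_cast
    have := mul_le_mul_of_nonneg_left (show 2 * (m ^ 2 * b ^ 2 * κ) ≤ e - 2 * ε by linarith)
      (Nat.cast_nonneg (α := ℝ) n)
    linarith
  -- For the close pairs the saved factor `2 ^ n` must beat the missing second probability `exp (-n
  -- m b² / 2)`; this is where `m b² / 2 < log 2` enters.
  have hE1 : exp (n * ε) * exp (n * (b ^ 2 * (m * (m * κ - 1)) / 2)) ≤
      2 ^ n * (4 * q ^ 2 * exp (n * e)) := by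
    rw [hq, div_pow, ← exp_nat_mul, show 4 * (exp (((2 : ℕ) : ℝ) * -(n * (m * b ^ 2 / 2 + ε))) /
      2 ^ 2) = exp (((2 : ℕ) : ℝ) * -(n * (m * b ^ 2 / 2 + ε))) by ring, ← exp_add, ← exp_add,
      show (2 : ℝ) ^ n = exp (n * log 2) by rw [exp_nat_mul, exp_log (by norm_num)], ← exp_add,
      exp_le_exp]
    push_cast
    have := mul_le_mul_of_nonneg_left (show ε + m ^ 2 * b ^ 2 * κ / 2 ≤
      log 2 - m * b ^ 2 / 2 - 2 * ε + e by linarith) (Nat.cast_nonneg (α := ℝ) n)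
    linarith
  have hmain : (2 ^ n * q) ^ 2 ≤ (disorderLaw n p).real (tupleEvent n p m b ξ η) *
      (2 ^ n * (2 ^ n * (4 * q ^ 2 * exp (n * e)) +
        m ^ 2 * 2 * (2 ^ n * (4 * q ^ 2 * exp (n * e))))) := by
    refine (pow_le_pow_left₀ (by positivity) hz 2).trans ((sq_sum_measureReal_le hAm).trans ?_)
    refine mul_le_mul (measureReal_mono hsub) (hW.trans ?_)
      (Finset.sum_nonneg fun _ _ => Finset.sum_nonneg fun _ _ => measureReal_nonneg)
      measureReal_nonneg
    have h3 := mul_le_mul_of_nonneg_left hE1 (show (0 : ℝ) ≤ m ^ 2 * 2 by positivity)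
    have h4 := mul_le_mul_of_nonneg_left hE2 (show (0 : ℝ) ≤ 2 ^ n by positivity)
    refine mul_le_mul_of_nonneg_left ?_ (by positivity)
    linarith
  have hpos : (0 : ℝ) < (2 ^ n * q) ^ 2 := by positivity
  have h5 : (2 ^ n * q) ^ 2 * 1 ≤ (2 ^ n * q) ^ 2 * ((4 + 8 * m ^ 2) *
      (disorderLaw n p).real (tupleEvent n p m b ξ η) * exp (n * e)) := by
    rw [mul_one]
    refine hmain.trans (le_of_eq ?_)
    ring
  have h6 := le_of_mul_le_mul_left h5 hpos
  rw [exp_neg, inv_le_iff_one_le_mul₀ (exp_pos _)]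
  linarith


/-! ### Gaussian concentration by small rotations -/

instance isGaussian_disorderLaw (n p : ℕ) : IsGaussian (disorderLaw n p) := by
  have h : HasGaussianLaw (fun J : Disorder n p => fun i => J i) (disorderLaw n p) := by
    refine iIndepFun.hasGaussianLaw (fun i => ⟨?_⟩) ?_
    · rw [disorderLaw, (measurePreserving_eval (fun _ => gaussianReal 0 1) i).map_eq]
      infer_instance
    · exact iIndepFun_pi (X := fun _ => id) fun _ => aemeasurable_id
  simpa using h.isGaussian_map

theorem integral_id_disorderLaw (n p : ℕ) : ∫ J, id J ∂(disorderLaw n p) = 0 := by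
  ext i
  have h := ContinuousLinearMap.integral_comp_comm
    (ContinuousLinearMap.proj (R := ℝ) (φ := fun _ : Fin p → Fin n => ℝ) i)
    (IsGaussian.integrable_id (μ := disorderLaw n p))
  have h2 : ∫ J : Disorder n p, J i ∂(disorderLaw n p) = ∫ x, x ∂(gaussianReal 0 1) := by
    rw [← (measurePreserving_eval (fun _ : Fin p → Fin n => gaussianReal 0 1) i).map_eq,
      integral_map (measurable_pi_apply i).aemeasurable (by fun_prop)]
    rfl
  rw [integral_id_gaussianReal] at h2
  exact h.symm.trans h2

theorem measurePreserving_rotation (n p : ℕ) (θ : ℝ) :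
    MeasurePreserving (ContinuousLinearMap.rotation θ)
      ((disorderLaw n p).prod (disorderLaw n p)) ((disorderLaw n p).prod (disorderLaw n p)) :=
  ⟨(ContinuousLinearMap.continuous _).measurable,
    IsGaussian.map_rotation_eq_self (integral_id_disorderLaw n p) θ⟩

theorem measureReal_prod_le_of_forall {α β : Type*} [MeasurableSpace α] [MeasurableSpace β]
    {μ : Measure α} {ν : Measure β} [IsProbabilityMeasure μ] [IsProbabilityMeasure ν]
    {s : Set (α × β)} (hs : MeasurableSet s) {c : ℝ} (hc : 0 ≤ c)
    (h : ∀ x, ν.real (Prod.mk x ⁻¹' s) ≤ c) : (μ.prod ν).real s ≤ c := by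
  rw [Measure.real, Measure.prod_apply hs]
  refine ENNReal.toReal_le_of_le_ofReal hc ?_
  calc ∫⁻ x, ν (Prod.mk x ⁻¹' s) ∂μ ≤ ∫⁻ _, ENNReal.ofReal c ∂μ :=
        lintegral_mono fun x => by
          rw [← ofReal_measureReal]
          exact ENNReal.ofReal_le_ofReal (h x)
    _ = ENNReal.ofReal c := by simp

/-- A small rotation of the disorder rarely destroys a tuple of configurations with large
energies. -/
theorem measureReal_rotation_diff_le {n p m : ℕ} (hn : n ≠ 0) {x y w θ ξ η : ℝ} (hw : 0 ≤ w)
    (hcos : 0 ≤ cos θ) (hsin : 0 < sin θ) (hy : y ≤ cos θ * x - sin θ * w) :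
    ((disorderLaw n p).prod (disorderLaw n p)).real
      {z | z.1 ∈ tupleEvent n p m x ξ η ∧
        cos θ • z.1 + sin θ • z.2 ∉ tupleEvent n p m y ξ η} ≤ m * exp (-(n * (w ^ 2 / 2))) := by
  have hmeas : MeasurableSet {z : Disorder n p × Disorder n p | z.1 ∈ tupleEvent n p m x ξ η ∧
      cos θ • z.1 + sin θ • z.2 ∉ tupleEvent n p m y ξ η} := by
    refine (measurable_fst (measurableSet_tupleEvent n p m x ξ η)).inter
      (MeasurableSet.compl ?_)
    have hc : Measurable fun z : Disorder n p × Disorder n p => cos θ • z.1 + sin θ • z.2 := by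
      fun_prop
    exact hc (measurableSet_tupleEvent n p m y ξ η)
  refine measureReal_prod_le_of_forall hmeas (by positivity) fun J => ?_
  by_cases hJ : J ∈ tupleEvent n p m x ξ η
  -- A witness `σ` depends on `J` only, hence is independent of the second disorder. The union bound
  -- thus runs over its `m` members rather than over all configurations.
  · obtain ⟨σ, hσ, hov⟩ := hJ
    have hsub : (Prod.mk J ⁻¹' {z : Disorder n p × Disorder n p |
        z.1 ∈ tupleEvent n p m x ξ η ∧
          cos θ • z.1 + sin θ • z.2 ∉ tupleEvent n p m y ξ η}) ⊆
        ⋃ t, {J' | hamiltonian J' (σ t) ≤ -w} := by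
      rintro J' ⟨-, hJ'⟩
      by_contra hcon
      simp only [Set.mem_iUnion, Set.mem_ofPred_eq, not_exists, not_le] at hcon
      refine hJ' ⟨σ, fun t => ?_, hov⟩
      rw [hamiltonian_add_smul]
      have h1 := mul_le_mul_of_nonneg_left (hσ t) hcos
      have h2 := mul_le_mul_of_nonneg_left (hcon t).le hsin.le
      linarith
    refine (measureReal_mono hsub).trans ((measureReal_iUnion_fintype_le _).trans ?_)
    refine (Finset.sum_le_sum fun t _ => measureReal_hamiltonian_le_neg_le hn (σ t) hw).trans_eq ?_
    simp
  · have : (Prod.mk J ⁻¹' {z : Disorder n p × Disorder n p |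
        z.1 ∈ tupleEvent n p m x ξ η ∧
          cos θ • z.1 + sin θ • z.2 ∉ tupleEvent n p m y ξ η}) = ∅ := by
      ext J'; simp [hJ]
    rw [this, measureReal_empty]
    positivity

/-- Gaussian concentration for the largest energy level reached by a tuple: lowering the level by
`b - a` turns an event whose probability is not too small into one of high probability. -/
theorem exists_measureReal_tupleEvent_mul_le (m : ℕ) {a b : ℝ} (ha : 0 ≤ a) (hab : a < b) :
    ∃ K : ℕ, ∀ n p : ℕ, n ≠ 0 → ∀ ξ η : ℝ,
      (disorderLaw n p).real (tupleEvent n p m b ξ η) *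
        (1 - (disorderLaw n p).real (tupleEvent n p m a ξ η)) ≤
      K * (m * exp (-(n * ((b - a) ^ 2 / 32)))) := by
  set δ := b - a with hδ
  have hδ0 : 0 < δ := sub_pos.2 hab
  -- A quarter turn, split into `K` rotations, carries `J` to an independent copy. Each step may
  -- lower the level by `δ / K`: half covers the loss `Δ² b / 2` from `cos Δ < 1`, which needs `4 b
  -- ≤ K δ`, and half covers `sin Δ * (δ / 4)`. The noise allowance `δ / 4` does not shrink with
  -- `K`, so the rate `δ² / 32` does not either.
  set K := max 2 ⌈4 * b / δ⌉₊ with hK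
  have hK2 : (2 : ℝ) ≤ K := by exact_mod_cast le_max_left _ _
  have hKb : 4 * b ≤ K * δ := by
    rw [← div_le_iff₀ hδ0]
    exact (Nat.le_ceil _).trans (by exact_mod_cast le_max_right _ _)
  have hK0 : (0 : ℝ) < K := by linarith
  refine ⟨K, fun n p hn ξ η => ?_⟩
  set μ := disorderLaw n p
  set Δ := π / (2 * K) with hΔ
  have hΔ0 : 0 < Δ := by positivity
  have hΔ2 : Δ ≤ 2 / K := by
    rw [hΔ, div_le_div_iff₀ (by positivity) hK0]
    nlinarith [pi_le_four]
  have hΔπ : Δ < π / 2 := by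
    rw [hΔ]
    exact div_lt_div_of_pos_left pi_pos (by norm_num) (by linarith)
  have hcos : 0 ≤ cos Δ := cos_nonneg_of_neg_pi_div_two_le_of_le (by linarith) hΔπ.le
  have hsin : 0 < sin Δ := sin_pos_of_pos_of_lt_pi hΔ0 (by linarith)
  let B : ℕ → Set (Disorder n p) := fun k => tupleEvent n p m (b - k * (δ / K)) ξ η
  let R : ℕ → Disorder n p × Disorder n p → Disorder n p × Disorder n p := fun k =>
    ContinuousLinearMap.rotation (k * Δ)
  have hR : ∀ k z, (R (k + 1) z).1 = cos Δ • (R k z).1 + sin Δ • (R k z).2 := by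
    intro k z
    simp only [R, ContinuousLinearMap.rotation_apply, Nat.cast_add, Nat.cast_one, add_mul, one_mul,
      cos_add, sin_add]
    module
  have hstep : ∀ k < K, (μ.prod μ).real {z | (R k z).1 ∈ B k ∧ (R (k + 1) z).1 ∉ B (k + 1)} ≤
      m * exp (-(n * (δ ^ 2 / 32))) := by
    intro k hk
    have hkK : (k : ℝ) * (δ / K) ≤ δ := by
      rw [mul_div_assoc', div_le_iff₀ hK0, mul_comm]
      gcongr
    have hx0 : 0 ≤ b - k * (δ / K) := by linarith
    have hxb : b - k * (δ / K) ≤ b := by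
      have : 0 ≤ k * (δ / K) := by positivity
      linarith
    have hy : b - ((k + 1 : ℕ) : ℝ) * (δ / K) ≤
        cos Δ * (b - k * (δ / K)) - sin Δ * (δ / 4) := by
      have h1 : (1 - Δ ^ 2 / 2) * (b - k * (δ / K)) ≤ cos Δ * (b - k * (δ / K)) :=
        mul_le_mul_of_nonneg_right (one_sub_sq_div_two_le_cos) hx0
      have h2 : sin Δ * (δ / 4) ≤ δ / K / 2 := by
        have := mul_le_mul_of_nonneg_right ((sin_le hΔ0.le).trans hΔ2)
          (show 0 ≤ δ / 4 by positivity)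
        refine this.trans_eq ?_
        field_simp
        norm_num
      have h3 : Δ ^ 2 / 2 * (b - k * (δ / K)) ≤ δ / K / 2 := by
        calc Δ ^ 2 / 2 * (b - k * (δ / K)) ≤ (2 / K) ^ 2 / 2 * b := by gcongr
          _ = 4 * b / (2 * K ^ 2) := by ring
          _ ≤ K * δ / (2 * K ^ 2) := by gcongr
          _ = δ / K / 2 := by field_simp
      push_cast
      linarith
    have h := measureReal_rotation_diff_le (p := p) (m := m) (ξ := ξ) (η := η) hn
      (show 0 ≤ δ / 4 by positivity) hcos hsin hy
    have hpre : {z | (R k z).1 ∈ B k ∧ (R (k + 1) z).1 ∉ B (k + 1)} = R k ⁻¹'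
        {z | z.1 ∈ B k ∧ cos Δ • z.1 + sin Δ • z.2 ∉ B (k + 1)} := by
      ext z; simp only [Set.mem_ofPred_eq, Set.mem_preimage, hR]
    have hmeas : MeasurableSet {z : Disorder n p × Disorder n p |
        z.1 ∈ B k ∧ cos Δ • z.1 + sin Δ • z.2 ∉ B (k + 1)} := by
      refine (measurable_fst (measurableSet_tupleEvent n p m _ ξ η)).inter
        (MeasurableSet.compl ?_)
      have hc : Measurable fun z : Disorder n p × Disorder n p => cos Δ • z.1 + sin Δ • z.2 := by
        fun_prop
      exact hc (measurableSet_tupleEvent n p m _ ξ η)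
    rw [hpre, Measure.real,
      (measurePreserving_rotation n p (k * Δ)).measure_preimage hmeas.nullMeasurableSet]
    refine h.trans_eq ?_
    congr 3; ring
  -- If the initial disorder succeeds at level `b` and the final one fails at level `a`, some single
  -- step must lose the tuple.
  have hsub : B 0 ×ˢ (B K)ᶜ ⊆
      ⋃ k : Fin K, {z | (R k z).1 ∈ B k ∧ (R (k + 1) z).1 ∉ B (k + 1)} := by
    rintro z ⟨hz0, hzK⟩
    by_contra hcon
    simp only [Set.mem_iUnion, Set.mem_ofPred_eq, not_exists, not_and, not_not] at hcon
    have hall : ∀ k ≤ K, (R k z).1 ∈ B k := by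
      intro k
      induction k with
      | zero => intro _; simpa [R, ContinuousLinearMap.rotation_apply] using hz0
      | succ k ih => intro hk; exact hcon ⟨k, hk⟩ (ih (Nat.le_of_succ_le hk))
    have hKΔ : K * Δ = π / 2 := by rw [hΔ]; field_simp
    have := hall K le_rfl
    simp only [R, ContinuousLinearMap.rotation_apply, hKΔ, cos_pi_div_two, sin_pi_div_two,
      zero_smul, one_smul, zero_add] at this
    exact hzK this
  have hB0 : B 0 = tupleEvent n p m b ξ η := by simp [B]
  have hBK : B K = tupleEvent n p m a ξ η := by
    simp only [B]
    congr 1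
    rw [mul_div_cancel₀ _ hK0.ne', hδ]; ring
  have hprod : (μ.prod μ).real (B 0 ×ˢ (B K)ᶜ) = μ.real (tupleEvent n p m b ξ η) *
      (1 - μ.real (tupleEvent n p m a ξ η)) := by
    rw [measureReal_prod_prod, hB0, hBK,
      probReal_compl_eq_one_sub (measurableSet_tupleEvent n p m a ξ η)]
  rw [← hprod]
  refine (measureReal_mono hsub).trans ((measureReal_iUnion_fintype_le _).trans ?_)
  refine (Finset.sum_le_sum fun (k : Fin K) _ => hstep k k.2).trans_eq ?_
  simp

end PSpin

/-! ### Combining the two bounds -/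

theorem mainTheorem2 (m : ℕ) (hm : 1 ≤ m) (γ : ℝ) (hγ : γ < 1 / Real.sqrt (m : ℝ))
    (ξ η : ℝ) (hη : 0 < η) (hηξ : η < ξ) (hξ : ξ < 1) :
    ∃ Pstar : ℕ, ∀ p : ℕ, Pstar ≤ p →
      ∃ c : ℝ, 0 < c ∧ ∃ N : ℕ, ∀ n : ℕ, N ≤ n →
        1 - Real.exp (-(c * (n : ℝ))) ≤
          (PSpin.disorderLaw n p).real
            {J : PSpin.Disorder n p | (PSpin.nearOptimalTuples J γ m ξ η).Nonempty} := by
  have hm0 : (0 : ℝ) < m := by exact_mod_cast hm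
  have hlog : 0 < log 2 := log_pos (by norm_num)
  set s := √(2 * log 2) with hs
  have hs0 : 0 < s := by positivity
  -- The exponential bounds need nonnegative levels; raising a negative `γ` to `0` only shrinks the
  -- event.
  set γ₀ := max γ 0 with hγ₀
  have hγ₀0 : 0 ≤ γ₀ := le_max_right _ _
  have hγ₀m : γ₀ < 1 / √m := max_lt hγ (by positivity)
  obtain ⟨g, hg₀, hgm⟩ := exists_between hγ₀m
  have hbm : m * (g * s) ^ 2 / 2 < log 2 := by
    have h1 : g * √m < 1 := (lt_div_iff₀ (by positivity)).1 hgm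
    have h2 : (g * √m) ^ 2 < 1 :=
      pow_lt_one₀ (mul_nonneg (hγ₀0.trans hg₀.le) (sqrt_nonneg _)) h1 two_ne_zero
    rw [mul_pow, sq_sqrt hm0.le] at h2
    rw [mul_pow, hs, sq_sqrt (by positivity)]
    nlinarith
  have hab : γ₀ * s < g * s := mul_lt_mul_of_pos_right hg₀ hs0
  set D := (g * s - γ₀ * s) ^ 2 with hD
  have hD0 : 0 < D := pow_pos (sub_pos.2 hab) 2
  -- The concentration rate is `D / 32`. Spending `D / 64` on the weak lower bound leaves `D / 64`,
  -- of which half absorbs the constant `C * (K * m)` and half, `D / 128`, is the final rate.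
  obtain ⟨P, hP⟩ := PSpin.exists_le_measureReal_tupleEvent m
    (mul_nonneg (hγ₀0.trans hg₀.le) hs0.le) hbm hη hηξ hξ (show 0 < D / 64 by positivity)
  obtain ⟨K, hK⟩ := PSpin.exists_measureReal_tupleEvent_mul_le m
    (mul_nonneg hγ₀0 hs0.le) hab
  refine ⟨P, fun p hp => ⟨D / 128, by positivity, ?_⟩⟩
  obtain ⟨C, hC, N₁, hN₁⟩ := hP p hp
  obtain ⟨N₂, hN₂⟩ : ∃ N : ℕ, ∀ n ≥ N, C * (K * m) * exp (-(n * (D / 128))) ≤ 1 := by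
    have : Filter.Tendsto (fun n : ℕ => C * (K * m) * exp (-(n * (D / 128)))) Filter.atTop
        (nhds (C * (K * m) * 0)) :=
      ((tendsto_exp_neg_atTop_nhds_zero.comp
        (tendsto_natCast_atTop_atTop.atTop_mul_const (by positivity))).const_mul _)
    rw [mul_zero] at this
    exact Filter.eventually_atTop.1 (this.eventually_le_const one_pos)
  refine ⟨max (max N₁ N₂) 1, fun n hn => ?_⟩
  have hn0 : n ≠ 0 := by have := le_of_max_le_right hn; omega
  have h1 := hN₁ n ((le_max_left _ _).trans (le_of_max_le_left hn))
  have h2 := hN₂ n ((le_max_right _ _).trans (le_of_max_le_left hn))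
  have h3 := hK n p hn0 ξ η
  set q := (PSpin.disorderLaw n p).real (PSpin.tupleEvent n p m (γ₀ * s) ξ η) with hq
  have hq1 : 0 ≤ 1 - q := sub_nonneg.2 measureReal_le_one
  have hsub : PSpin.tupleEvent n p m (γ₀ * s) ξ η ⊆
      {J : PSpin.Disorder n p | (PSpin.nearOptimalTuples J γ m ξ η).Nonempty} := by
    rintro J ⟨σ, hσ, hov⟩
    exact ⟨σ, fun t => (mul_le_mul_of_nonneg_right (le_max_left _ _) hs0.le).trans (hσ t), hov⟩
  refine le_trans ?_ (measureReal_mono hsub)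
  have h4 : exp (-(n * (D / 64))) * (1 - q) ≤
      exp (-(n * (D / 64))) * exp (-(D / 128 * n)) := by
    calc exp (-(n * (D / 64))) * (1 - q)
        ≤ C * (PSpin.disorderLaw n p).real (PSpin.tupleEvent n p m (g * s) ξ η) * (1 - q) :=
          mul_le_mul_of_nonneg_right h1 hq1
      _ ≤ C * (K * (m * exp (-(n * (D / 32))))) := by
          rw [mul_assoc]
          exact mul_le_mul_of_nonneg_left h3 hC.le
      _ = C * (K * m) * exp (-(n * (D / 128))) * (exp (-(n * (D / 64))) * exp (-(D / 128 * n))) := by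
          rw [mul_assoc (C * (K * m)), ← exp_add, ← exp_add, mul_assoc, mul_assoc]
          congr 4; ring
      _ ≤ exp (-(n * (D / 64))) * exp (-(D / 128 * n)) :=
          mul_le_of_le_one_left (by positivity) h2
  have h5 := le_of_mul_le_mul_left h4 (exp_pos _)
  linarith
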